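/- Let $K, M \ge 1$. In the $K$ user parallel ADT deterministic interference network with $M$ sub-channels, the channel strengths are nonnegative integers $n_{ki}^{[m]}$ (from Transmitter $i$ to Receiver $k$ on sub-channel $m$). In each channel use Transmitter $i$ sends on sub-channel $m$ an input $X_i^{[m]} = 0.X_{i,(1)}^{[m]}X_{i,(2)}^{[m]}\ldots$ (base 2), and Receiver $k$ observes $$Y_k^{[m]} = \lfloor 2^{n_{k1}^{[m]}}X_1^{[m]}\rfloor \oplus\cdots\oplus \lfloor 2^{n_{kK}^{[m]}}X_K^{[m]}\rfloor ,\qquad m=1,\dots,M,$$ where $\oplus$ is bit-wise addition modulo two. A tuple $(R_1,\dots,R_K)$ of nonnegative rates is achievable if there are codes of every length $T$, with independent messages $W_i$ uniform on $\{1,\dots,\lceil 2^{TR_i}\rceil\}$, encoded by Transmitter $i$ over all sub-channels and decoded by Receiver $i$ from its outputs on all sub-channels, such that each receiver's error probability tends to $0$ as $T\to\infty$. The capacity region is the closure of the set of achievable tuples, and the sum-capacity is the maximum of $\sum_k R_k$ over it. *TIN optimality.* Sub-channel $m$ is TIN optimal if $n_{ii}^{[m]} \ge \max_{j\ne i} n_{ji}^{[m]}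 + \max_{k\neq i} n_{ik}^{[m]}$ for all $i$ (a maximum over the empty set is $0$). *Cyclic partitions.* A cyclic partition $\Pi$ is a decomposition of the users into disjoint cycles, i.e. the cycle decomposition of a permutation $k\mapsto\Pi(k)$ of $\{1,\dots,K\}$; its weight on sub-channel $m$ is $w(\Pi)=\sum_{k:\Pi(k)\neq k} n_{\Pi(k)k}^{[m]}$. An optimal cyclic partition $\Pi^{[m]*}$ is one of maximum weight on sub-channel $m$. *Invertibility.* For a cyclic partition $\Pi$ of sub-channel $m$, let $X_{i,u}^{[m]}$ consist of the first $n^{[m]}_{\Pi(i)i}$ bits of $X_i^{[m]}$ (no bits if $\Pi(i)=i$), and let $Y_{k,u}^{[m]}=\bigoplus_{i\neq k}\lfloor 2^{n_{ki}^{[m]}}X_{i,u}^{[m]}\rfloor$. Sub-channel $m$ is invertible if for some optimal cyclic partition the map $(X_{1,u}^{[m]},\dots,X_{K,u}^{[m]})\mapsto(Y_{1,u}^{[m]},\dots,Y_{K,u}^{[m]})$ is injective. *Separate TIN.* Given power back-offs $r_i^{[m]}\in\{0,1,2,\dots\}$, let the first $r_i^{[m]}$ bits of $X_i^{[m]}$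 be $0$ and let all other input bits be independent and uniform. Treating interference as noise (TIN) on sub-channel $m$ gives user $i$ the rate $R_i^{[m]} = I(X_i^{[m]};Y_i^{[m]})$, and separate TIN over all sub-channels gives user $i$ the total rate $\sum_m R_i^{[m]}$. **Theorem.** If every sub-channel is TIN optimal and invertible, then the sum-capacity of the parallel network is $$\sum_{m=1}^M\Big[\sum_{i=1}^K n_{ii}^{[m]} - w(\Pi^{[m]*})\Big],$$ and it is achieved by separate TIN over each sub-channel: there are back-offs $r_i^{[m]}$ such that, for every $m$, the TIN rates $(R_1^{[m]},\dots,R_K^{[m]})$ lie in the capacity region of sub-channel $m$ by itself and satisfy $\sum_i R_i^{[m]}=\sum_i n_{ii}^{[m]}-w(\Pi^{[m]*})$, and the tuple $\big(\sum_m R_1^{[m]},\dots,\sum_m R_K^{[m]}\big)$ lies in the capacity region of the parallel network and attains its sum-capacity. -/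

import Mathlib

open Filter Topology

namespace ADT

/-- A channel input `0.X₍₁₎X₍₂₎X₍₃₎…` in base 2 (or any signal given by its bits), with bit-wise
addition modulo two. For an input, `X b` is the bit `X₍b+1₎`, i.e. the coefficient of `2^{-(b+1)}`;
for an output, `Y p` is the coefficient of `2^p`. -/
abbrev Signal : Type := ℕ → ZMod 2

/-- The bits of the integer `⌊2^s X⌋` for `X = 0.X₍₁₎X₍₂₎…`: for `p < s` the coefficient of `2^p`
is `X₍s-p₎`, and the coefficients of the higher powers of two vanish. -/
def scaleFloor (s : ℕ) (X : Signal) : Signal :=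
  fun p => if p < s then X (s - 1 - p) else 0

/-- One sub-channel with strengths `n`, where `n k i` is the strength from Transmitter `i` to
Receiver `k`: the output `⌊2^{n k 1} X₁⌋ ⊕ ⋯ ⊕ ⌊2^{n k K} X_K⌋` at Receiver `k`. -/
def output {K : ℕ} (n : Fin K → Fin K → ℕ) (X : Fin K → Signal) (k : Fin K) : Signal :=
  ∑ i, scaleFloor (n k i) (X i)

section Capacity

/-- The number `⌈2^{TR}⌉` of messages of a user of rate `R` over `T` channel uses. -/
noncomputable def numMessages (T : ℕ) (R : ℝ) : ℕ := ⌈(2 : ℝ) ^ ((T : ℝ) * R)⌉₊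

/-- A code of length `T` at rates `R` for a `K` user network with `M` sub-channels. -/
structure Code (K M T : ℕ) (R : Fin K → ℝ) where
  /-- `enc i w t m` is the symbol sent by Transmitter `i` on sub-channel `m` in channel use `t`. -/
  enc : ∀ i, Fin (numMessages T (R i)) → Fin T → Fin M → Signal
  /-- The estimate of `W_k` from the outputs of all sub-channels in all channel uses. -/
  dec : ∀ k, (Fin T → Fin M → Signal) → Fin (numMessages T (R k))

/-- What Receiver `k` observes when the messages are `w`. -/
def Code.received {K M T : ℕ} {R : Fin K → ℝ} (c : Code K M T R)
    (n : Fin M → Fin K → Fin K → ℕ) (w : ∀ i, Fin (numMessages T (R i))) (k : Fin K) :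
    Fin T → Fin M → Signal :=
  fun t m => output (n m) (fun i => c.enc i (w i) t m) k

/-- The probability that Receiver `k` decodes wrongly, for independent uniform messages. -/
noncomputable def Code.errorProb {K M T : ℕ} {R : Fin K → ℝ} (c : Code K M T R)
    (n : Fin M → Fin K → Fin K → ℕ) (k : Fin K) : ℝ :=
  ((Finset.univ.filter fun w : ∀ i, Fin (numMessages T (R i)) =>
      c.dec k (c.received n w k) ≠ w k).card : ℝ) /
    (Fintype.card (∀ i, Fin (numMessages T (R i))) : ℝ)

/-- `R` is achievable over the parallel network with strengths `n m k i`. -/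
def Achievable {K M : ℕ} (n : Fin M → Fin K → Fin K → ℕ) (R : Fin K → ℝ) : Prop :=
  (∀ i, 0 ≤ R i) ∧ ∃ c : ∀ T : ℕ, Code K M T R,
    ∀ k, Tendsto (fun T => (c T).errorProb n k) atTop (𝓝 0)

/-- The capacity region. -/
def capacityRegion {K M : ℕ} (n : Fin M → Fin K → Fin K → ℕ) : Set (Fin K → ℝ) :=
  closure {R | Achievable n R}

/-- `C` is the sum-capacity, the maximum of `R₁ + ⋯ + R_K` over the capacity region. -/
def IsSumCapacity {K M : ℕ} (n : Fin M → Fin K → Fin K → ℕ) (C : ℝ) : Prop :=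
  IsGreatest ((fun R : Fin K → ℝ => ∑ k, R k) '' capacityRegion n) C

end Capacity

section Partition

/-- The TIN optimality condition of a sub-channel. -/
def TINOptimal {K : ℕ} (n : Fin K → Fin K → ℕ) : Prop :=
  ∀ i, ((Finset.univ.erase i).sup fun j => n j i) + ((Finset.univ.erase i).sup fun k => n i k)
    ≤ n i i

/-- The weight of the edge `e_{ij}` from user `j` to user `i`. -/
def edgeWeight {K : ℕ} (n : Fin K → Fin K → ℕ) (i j : Fin K) : ℕ :=
  if i = j then 0 else n i j

/-- The weight of a cyclic partition. A partition of the users into disjoint cycles is the cycle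
decomposition of a permutation `P`: the edges of its cycles are `e_{P(k) k}`, fixed points are the
trivial cycles, and `P k` is the cyclic predecessor of `k` if `k` is not fixed. -/
def partitionWeight {K : ℕ} (n : Fin K → Fin K → ℕ) (P : Equiv.Perm (Fin K)) : ℕ :=
  ∑ k, edgeWeight n (P k) k

/-- `P` gives the tightest cyclic partition bound `∑ i, n i i - w(P)`. -/
def IsOptimalPartition {K : ℕ} (n : Fin K → Fin K → ℕ) (P : Equiv.Perm (Fin K)) : Prop :=
  ∀ Q : Equiv.Perm (Fin K), partitionWeight n Q ≤ partitionWeight n P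

/-- The participating input levels of Transmitter `i`: the bits of `X i` that are seen at the
cyclic predecessor `P i` of `i` (none if `i` is in a trivial cycle), as a signal whose other bits
are zero. -/
def participatingInput {K : ℕ} (n : Fin K → Fin K → ℕ) (P : Equiv.Perm (Fin K))
    (X : Fin K → Signal) (i : Fin K) : Signal :=
  fun b => if b < edgeWeight n (P i) i then X i b else 0

/-- The participating output levels of Receiver `k`: the interference that results from the
participating input levels. -/
def participatingOutput {K : ℕ} (n : Fin K → Fin K → ℕ) (P : Equiv.Perm (Fin K))
    (X : Fin K → Signal) (k : Fin K) : Signal :=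
  ∑ i ∈ Finset.univ.erase k, scaleFloor (n k i) (participatingInput n P X i)

/-- A sub-channel is invertible if, for some optimal cyclic partition, the participating outputs
of all receivers determine the participating inputs of all transmitters. -/
def IsInvertible {K : ℕ} (n : Fin K → Fin K → ℕ) : Prop :=
  ∃ P, IsOptimalPartition n P ∧ ∀ X X' : Fin K → Signal,
    participatingOutput n P X = participatingOutput n P X' →
      participatingInput n P X = participatingInput n P X'

end Partition

section TIN

open scoped Classical in
/-- The Shannon entropy in bits of `f ω` for `ω` uniform on the finite set `Ω`. -/
noncomputable def entropy {Ω α : Type*} [Fintype Ω] (f : Ω → α) : ℝ :=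
  ∑ y ∈ Finset.univ.image f,
    Real.negMulLog (((Finset.univ.filter fun ω => f ω = y).card : ℝ) / Fintype.card Ω) / Real.log 2

/-- The mutual information in bits of `f ω` and `g ω` for `ω` uniform on `Ω`. -/
noncomputable def mutualInfo {Ω α β : Type*} [Fintype Ω] (f : Ω → α) (g : Ω → β) : ℝ :=
  entropy f + entropy g - entropy fun ω => (f ω, g ω)

/-- The largest channel strength; bits of an input below this level reach no receiver. -/
def maxStrength {K : ℕ} (n : Fin K → Fin K → ℕ) : ℕ :=
  Finset.univ.sup fun k => Finset.univ.sup (n k)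

/-- The power-controlled inputs: Transmitter `i` scales its signal down by `2^{-r i}`, so that its
first `r i` bits vanish, and fills the remaining levels with independent bits `ω i b`. -/
def tinInput {K : ℕ} (q : ℕ) (r : Fin K → ℕ) (ω : Fin K → Fin q → ZMod 2) (i : Fin K) : Signal :=
  fun b => if h : b < q then (if r i ≤ b then ω i ⟨b, h⟩ else 0) else 0

/-- The rate `I(X_i; Y_i)` of user `i` on a sub-channel when every transmitter uses independent
uniform bits below its power level and every receiver treats the interference as noise. -/
noncomputable def tinRate {K : ℕ} (n : Fin K → Fin K → ℕ) (r : Fin K → ℕ) (i : Fin K) : ℝ :=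
  mutualInfo (Ω := Fin K → Fin (maxStrength n) → ZMod 2)
    (fun ω => tinInput (maxStrength n) r ω i)
    (fun ω => output n (tinInput (maxStrength n) r ω) i)

end TIN

end ADT

/-! Both directions rest on entropy counts and on linear programming duality for the assignment
problem.

Achievability. An optimal cyclic partition is a maximum weight permutation for the matrix of cross
strengths with zero diagonal. By Egerváry's theorem (`exists_dual_potentials`) there are integers
with `n i j ≤ a i + r j` off the diagonal and equality along the permutation; after a shift they are
nonnegative (`exists_backoff`). Taking `r` as back-offs, `a i` is the level below which all
interference at Receiver `i` stays. Tightness makes some interferer fill these levels, so the TIN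
rate is exactly `n i i - r i - a i` (`tinRate_eq`), and by duality these rates sum to the bound.
Uncoded bits on the clean levels achieve them without error (`achievable_of_backoff`).

Converse. Let `V k` be the bits of Transmitter `k` heard by some other receiver, `Z k` the low
output levels of Receiver `k`, which under TIN optimality contain all its interference `I k`, and
`D` the non-participating bits among all the `V k`. From `V k` and `Z k`, Receiver `k` recovers its
output, hence its message and `I k`. For independent messages this gives `H(W k) + H(I k) ≤ H(V k) +
H(Z k)`. The `V k` are then independent too, and invertibility lets all the `I k` together with `D`
determine them, so `∑ H(V k) ≤ ∑ H(I k) + H(D)`. The interference terms cancel, leaving `∑ H(Z k) +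
H(D)`, and counting bits bounds this by the cyclic partition bound. All sub-channels and channel
uses are treated jointly, so separate coding loses nothing in sum rate.

Decoding errors are handled without Fano's inequality: the messages are restricted to the tuples
that everyone decodes correctly. At least half of all tuples remain for large `T`, so independence
fails by at most one bit, which vanishes after division by `T` (`Code.sum_logb_numMessages_le`,
`Achievable.sum_le`). -/

namespace ADT

/-! ### Entropy of partitions of a finite uniform space. -/

section SetoidEntropy

open scoped Classical in
/-- The number of points equivalent to `ω`. -/
noncomputable def classCard {Ω : Type*} [Fintype Ω] (s : Setoid Ω) (ω : Ω) : ℕ :=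
  (Finset.univ.filter fun ω' => s ω ω').card

/-- The entropy in bits of the class of a uniform point of `Ω`. -/
noncomputable def setoidEntropy {Ω : Type*} [Fintype Ω] (s : Setoid Ω) : ℝ :=
  (∑ ω, (Real.logb 2 (Fintype.card Ω) - Real.logb 2 (classCard s ω))) / Fintype.card Ω

variable {Ω : Type*} [Fintype Ω]

lemma classCard_pos (s : Setoid Ω) (ω : Ω) : 0 < classCard s ω := by
  classical
  exact Finset.card_pos.2 ⟨ω, by simp⟩

lemma classCard_mono {s t : Setoid Ω} (h : s ≤ t) (ω : Ω) : classCard s ω ≤ classCard t ω := by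
  classical
  apply Finset.card_le_card
  intro x hx
  simp only [Finset.mem_filter, Finset.mem_univ, true_and] at hx ⊢
  exact h hx

lemma classCard_congr {s : Setoid Ω} {ω ω' : Ω} (h : s ω ω') :
    classCard s ω = classCard s ω' := by
  classical
  unfold classCard
  congr 1
  ext x
  simp only [Finset.mem_filter, Finset.mem_univ, true_and]
  exact ⟨fun hx => s.trans (s.symm h) hx, fun hx => s.trans h hx⟩

/-- A random variable is represented by its kernel: `s ≤ t` says that `s` determines `t`, and `⊓` is
the joint variable. -/
lemma setoidEntropy_anti {s t : Setoid Ω} (h : s ≤ t) : setoidEntropy t ≤ setoidEntropy s := by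
  unfold setoidEntropy
  gcongr with ω
  · norm_num
  · exact_mod_cast classCard_pos s ω
  · exact classCard_mono h ω

lemma setoidEntropy_bot [Nonempty Ω] :
    setoidEntropy (⊥ : Setoid Ω) = Real.logb 2 (Fintype.card Ω) := by
  classical
  have h : ∀ ω : Ω, classCard ⊥ ω = 1 := by
    intro ω
    refine Finset.card_eq_one.2 ⟨ω, ?_⟩
    ext x
    simp [eq_comm]
  have : (Fintype.card Ω : ℝ) ≠ 0 := by exact_mod_cast Fintype.card_ne_zero
  simp [setoidEntropy, h, mul_div_cancel_left₀ _ this]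

lemma setoidEntropy_top : setoidEntropy (⊤ : Setoid Ω) = 0 := by
  classical
  have h : ∀ ω : Ω, classCard ⊤ ω = Fintype.card Ω := by
    intro ω
    simp [classCard, Setoid.top_def]
  simp [setoidEntropy, h]

/-- If all classes have `Fintype.card Ω / N` points, the entropy is `log N`. -/
lemma setoidEntropy_eq_of_classCard_mul [Nonempty Ω] {s : Setoid Ω} {N : ℕ}
    (h : ∀ ω, classCard s ω * N = Fintype.card Ω) : setoidEntropy s = Real.logb 2 N := by
  have hΩ : (Fintype.card Ω : ℝ) ≠ 0 := by exact_mod_cast Fintype.card_ne_zero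
  have hN : (N : ℝ) ≠ 0 := by
    rintro h0
    have := h (Classical.arbitrary Ω)
    rw [Nat.cast_eq_zero.1 h0, mul_zero] at this
    exact Fintype.card_ne_zero this.symm
  have : ∀ ω, Real.logb 2 (Fintype.card Ω) - Real.logb 2 (classCard s ω) = Real.logb 2 N := by
    intro ω
    have hc : (classCard s ω : ℝ) ≠ 0 := by exact_mod_cast (classCard_pos s ω).ne'
    rw [← h ω, Nat.cast_mul, Real.logb_mul hc hN]
    ring
  simp only [setoidEntropy, this, Finset.sum_const, Finset.card_univ, nsmul_eq_mul]
  field_simp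

/-- Each nonempty fibre contributes exactly one, so the sum counts the values taken. -/
lemma sum_inv_classCard_ker {α : Type*} [Fintype α] (f : Ω → α) :
    ∑ ω, (1 : ℝ) / classCard (Setoid.ker f) ω ≤ Fintype.card α := by
  classical
  rw [← Finset.sum_fiberwise (s := Finset.univ) (g := f)]
  calc _ ≤ ∑ _y : α, (1 : ℝ) := by
        apply Finset.sum_le_sum
        intro y _
        have : ∀ ω ∈ Finset.univ.filter (fun ω => f ω = y),
            (1 : ℝ) / classCard (Setoid.ker f) ω =
              1 / (Finset.univ.filter (fun ω => f ω = y)).card := by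
          intro ω hω
          simp only [Finset.mem_filter, Finset.mem_univ, true_and] at hω
          simp only [classCard, Setoid.ker_def, hω, eq_comm]
        rw [Finset.sum_congr rfl this, Finset.sum_const, nsmul_eq_mul, mul_one_div]
        exact div_self_le_one _
    _ = _ := by simp

lemma logb_two_le_sub_one_div {x : ℝ} (hx : 0 < x) : Real.logb 2 x ≤ (x - 1) / Real.log 2 := by
  unfold Real.logb
  have := Real.log_pos (one_lt_two)
  gcongr
  exact Real.log_le_sub_one_of_pos hx

/-- Gibbs' inequality against the uniform law on `α`: apply `log x ≤ x - 1` with `x = |Ω| / (|α| ·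
|class|)` and average. -/
lemma setoidEntropy_ker_le_logb_card {α : Type*} [Fintype α] [Nonempty α] (f : Ω → α) :
    setoidEntropy (Setoid.ker f) ≤ Real.logb 2 (Fintype.card α) := by
  classical
  have hα : (0 : ℝ) < Fintype.card α := by exact_mod_cast Fintype.card_pos
  have hα1 : (1 : ℝ) ≤ Fintype.card α := by exact_mod_cast Fintype.card_pos
  rcases isEmpty_or_nonempty Ω with hΩ | hΩ
  · simpa [setoidEntropy] using Real.logb_nonneg one_lt_two hα1
  have hΩ : (0 : ℝ) < Fintype.card Ω := by exact_mod_cast Fintype.card_pos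
  have hl := Real.log_pos (one_lt_two (α := ℝ))
  have key : ∀ ω, Real.logb 2 (Fintype.card Ω) - Real.logb 2 (classCard (Setoid.ker f) ω) ≤
      Real.logb 2 (Fintype.card α) + (Fintype.card Ω / Fintype.card α *
        (1 / classCard (Setoid.ker f) ω) - 1) / Real.log 2 := by
    intro ω
    have hc : (0 : ℝ) < classCard (Setoid.ker f) ω := by exact_mod_cast classCard_pos _ ω
    have := logb_two_le_sub_one_div (x := Fintype.card Ω / Fintype.card α *
        (1 / classCard (Setoid.ker f) ω)) (by positivity)
    rw [Real.logb_mul (by positivity) (by positivity), Real.logb_div hΩ.ne' hα.ne', one_div,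
      Real.logb_inv] at this
    rw [one_div]
    linarith
  have h2 := sum_inv_classCard_ker f
  have h3 := Finset.sum_le_sum fun ω (_ : ω ∈ Finset.univ) => key ω
  rw [setoidEntropy, div_le_iff₀ hΩ]
  refine h3.trans ?_
  rw [Finset.sum_add_distrib, ← Finset.sum_div, Finset.sum_sub_distrib, ← Finset.mul_sum]
  simp only [Finset.sum_const, Finset.card_univ, nsmul_eq_mul, mul_one]
  have h4 : (Fintype.card Ω : ℝ) / Fintype.card α * ∑ ω, (1 : ℝ) / classCard (Setoid.ker f) ω
      ≤ Fintype.card Ω := by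
    calc _ ≤ (Fintype.card Ω : ℝ) / Fintype.card α * Fintype.card α := by gcongr
      _ = _ := by field_simp
  have h5 : ((Fintype.card Ω : ℝ) / Fintype.card α * ∑ ω, (1 : ℝ) / classCard (Setoid.ker f) ω
      - Fintype.card Ω) / Real.log 2 ≤ 0 := div_nonpos_of_nonpos_of_nonneg (by linarith) hl.le
  linarith

/-- Double counting: the numerator counts pairs `(ω₁, ω₂)` with `ω₁` in the `s ⊓ u` class and `ω₂`
in the `t ⊓ u` class of `ω`. For a fixed pair the admissible `ω` form one `s ⊓ t ⊓ u` class or none,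
and exist only if `u ω₁ ω₂`. Each pair thus contributes at most `1 / |u class|`, and summing over
`ω₂` leaves at most one for each `ω₁`. -/
lemma sum_classCard_ratio_le (s t u : Setoid Ω) :
    ∑ ω, (classCard (s ⊓ u) ω : ℝ) * classCard (t ⊓ u) ω /
      (classCard (s ⊓ t ⊓ u) ω * classCard u ω) ≤ Fintype.card Ω := by
  classical
  have expand : ∀ ω, (classCard (s ⊓ u) ω : ℝ) * classCard (t ⊓ u) ω /
      (classCard (s ⊓ t ⊓ u) ω * classCard u ω) =
      ∑ ω₁, ∑ ω₂, if (s ⊓ u) ω ω₁ ∧ (t ⊓ u) ω ω₂ then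
        (1 : ℝ) / (classCard (s ⊓ t ⊓ u) ω * classCard u ω) else 0 := by
    intro ω
    simp only [ite_and]
    simp only [Finset.sum_ite_irrel, Finset.sum_const_zero, ← Finset.sum_filter]
    simp only [Finset.sum_const, nsmul_eq_mul]
    unfold classCard
    ring
  simp only [expand]
  rw [Finset.sum_comm]
  simp only [Finset.sum_comm (s := Finset.univ) (t := Finset.univ)
    (f := fun ω ω₂ => if (s ⊓ u) ω _ ∧ (t ⊓ u) ω ω₂ then
        (1 : ℝ) / (classCard (s ⊓ t ⊓ u) ω * classCard u ω) else 0)]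
  have inner : ∀ ω₁ ω₂, (∑ ω, if (s ⊓ u) ω ω₁ ∧ (t ⊓ u) ω ω₂ then
        (1 : ℝ) / (classCard (s ⊓ t ⊓ u) ω * classCard u ω) else 0) ≤
        if u ω₁ ω₂ then 1 / (classCard u ω₁ : ℝ) else 0 := by
    intro ω₁ ω₂
    by_cases hex : ∃ ω₀, (s ⊓ u) ω₀ ω₁ ∧ (t ⊓ u) ω₀ ω₂
    · obtain ⟨ω₀, h1, h2⟩ := hex
      have hu : u ω₁ ω₂ := u.trans (u.symm h1.2) h2.2
      rw [if_pos hu, ← Finset.sum_filter]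
      have hset : Finset.univ.filter (fun ω => (s ⊓ u) ω ω₁ ∧ (t ⊓ u) ω ω₂) =
          Finset.univ.filter (fun ω => (s ⊓ t ⊓ u) ω₀ ω) := by
        ext ω
        simp only [Finset.mem_filter, Finset.mem_univ, true_and]
        constructor
        · rintro ⟨a, b⟩
          exact ⟨⟨s.trans h1.1 (s.symm a.1), t.trans h2.1 (t.symm b.1)⟩,
            u.trans h1.2 (u.symm a.2)⟩
        · rintro ⟨⟨a, b⟩, d⟩
          exact ⟨⟨s.trans (s.symm a) h1.1, u.trans (u.symm d) h1.2⟩,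
            ⟨t.trans (t.symm b) h2.1, u.trans (u.symm d) h2.2⟩⟩
      rw [hset]
      have : ∀ ω ∈ Finset.univ.filter (fun ω => (s ⊓ t ⊓ u) ω₀ ω),
          (1 : ℝ) / (classCard (s ⊓ t ⊓ u) ω * classCard u ω) =
          1 / (classCard (s ⊓ t ⊓ u) ω₀ * classCard u ω₁) := by
        intro ω hω
        simp only [Finset.mem_filter, Finset.mem_univ, true_and] at hω
        rw [classCard_congr (s := s ⊓ t ⊓ u) hω,
          classCard_congr (s := u) (u.trans (u.symm hω.2) h1.2)]
      rw [Finset.sum_congr rfl this, Finset.sum_const, nsmul_eq_mul]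
      have hc : (classCard (s ⊓ t ⊓ u) ω₀ : ℝ) ≠ 0 := by exact_mod_cast (classCard_pos _ _).ne'
      change (classCard (s ⊓ t ⊓ u) ω₀ : ℝ) * _ ≤ _
      apply le_of_eq
      field_simp
    · rw [Finset.sum_eq_zero]
      · split_ifs <;> positivity
      · intro ω _
        rw [if_neg fun h => hex ⟨ω, h⟩]
  calc _ ≤ ∑ ω₁, ∑ ω₂, if u ω₁ ω₂ then 1 / (classCard u ω₁ : ℝ) else 0 :=
        Finset.sum_le_sum fun ω₁ _ => Finset.sum_le_sum fun ω₂ _ => inner ω₁ ω₂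
    _ = ∑ _ω₁ : Ω, (1 : ℝ) := by
        apply Finset.sum_congr rfl
        intro ω₁ _
        rw [← Finset.sum_filter, Finset.sum_const, nsmul_eq_mul]
        have hc : (classCard u ω₁ : ℝ) ≠ 0 := by exact_mod_cast (classCard_pos _ _).ne'
        exact mul_one_div_cancel hc
    _ = _ := by simp

/-- Submodularity of entropy. -/
lemma setoidEntropy_submodular (s t u : Setoid Ω) :
    setoidEntropy (s ⊓ t ⊓ u) + setoidEntropy u ≤
      setoidEntropy (s ⊓ u) + setoidEntropy (t ⊓ u) := by
  have hl := Real.log_pos (one_lt_two (α := ℝ))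
  unfold setoidEntropy
  rw [← add_div, ← add_div, ← Finset.sum_add_distrib, ← Finset.sum_add_distrib]
  gcongr ?_ / _
  rw [← sub_nonpos, ← Finset.sum_sub_distrib]
  calc _ ≤ ∑ ω, ((classCard (s ⊓ u) ω : ℝ) * classCard (t ⊓ u) ω /
      (classCard (s ⊓ t ⊓ u) ω * classCard u ω) - 1) / Real.log 2 := by
        apply Finset.sum_le_sum
        intro ω _
        have h1 : (0 : ℝ) < classCard (s ⊓ u) ω := by exact_mod_cast classCard_pos _ _
        have h2 : (0 : ℝ) < classCard (t ⊓ u) ω := by exact_mod_cast classCard_pos _ _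
        have h3 : (0 : ℝ) < classCard (s ⊓ t ⊓ u) ω := by exact_mod_cast classCard_pos _ _
        have h4 : (0 : ℝ) < classCard u ω := by exact_mod_cast classCard_pos _ _
        refine le_trans (le_of_eq ?_) (logb_two_le_sub_one_div (by positivity))
        rw [Real.logb_div (by positivity) (by positivity), Real.logb_mul h1.ne' h2.ne',
          Real.logb_mul h3.ne' h4.ne']
        ring
    _ ≤ 0 := by
        rw [← Finset.sum_div, Finset.sum_sub_distrib]
        apply div_nonpos_of_nonpos_of_nonneg _ hl.le
        have := sum_classCard_ratio_le s t u
        simp only [Finset.sum_const, Finset.card_univ, nsmul_eq_mul, mul_one]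
        linarith

lemma setoidEntropy_inf_le (s t : Setoid Ω) :
    setoidEntropy (s ⊓ t) ≤ setoidEntropy s + setoidEntropy t := by
  simpa [setoidEntropy_top] using setoidEntropy_submodular s t ⊤

/-- Conditional entropy is subadditive. -/
lemma setoidEntropy_finset_inf_le {ι : Type*} (S : Finset ι) (s : ι → Setoid Ω) (u : Setoid Ω) :
    setoidEntropy (S.inf s ⊓ u) ≤
      setoidEntropy u + ∑ k ∈ S, (setoidEntropy (s k ⊓ u) - setoidEntropy u) := by
  classical
  induction S using Finset.induction_on with
  | empty => simp
  | insert k S hk ih =>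
    rw [Finset.inf_insert, Finset.sum_insert hk]
    have := setoidEntropy_submodular (s k) (S.inf s) u
    linarith

lemma setoidEntropy_finset_inf_le_sum {ι : Type*} (S : Finset ι) (s : ι → Setoid Ω) :
    setoidEntropy (S.inf s) ≤ ∑ k ∈ S, setoidEntropy (s k) := by
  simpa [setoidEntropy_top] using setoidEntropy_finset_inf_le S s ⊤

lemma setoidEntropy_le_card_bits {ι : Type*} [Fintype ι] {s : Setoid Ω} (f : Ω → ι → ZMod 2)
    (h : Setoid.ker f ≤ s) : setoidEntropy s ≤ Fintype.card ι := by
  classical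
  refine (setoidEntropy_anti h).trans ((setoidEntropy_ker_le_logb_card f).trans (le_of_eq ?_))
  simp [ZMod.card, Real.logb_pow]

/-- The dependence within a family of variables decreases when each is replaced by a function of
it. -/
lemma sum_setoidEntropy_sub_inf_le {ι : Type*} (S : Finset ι) (s t : ι → Setoid Ω)
    (h : ∀ k, s k ≤ t k) :
    ∑ k ∈ S, setoidEntropy (t k) - setoidEntropy (S.inf t) ≤
      ∑ k ∈ S, setoidEntropy (s k) - setoidEntropy (S.inf s) := by
  -- Chain rule relative to the joint coarse variable; below, conditioning on all of `S.inf t`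
  -- leaves no more entropy than conditioning on `t k` alone.
  have h1 := setoidEntropy_finset_inf_le S s (S.inf t)
  rw [inf_eq_left.2 (Finset.inf_mono_fun fun k _ => h k)] at h1
  have h2 : ∑ k ∈ S, (setoidEntropy (s k ⊓ S.inf t) - setoidEntropy (S.inf t)) ≤
      ∑ k ∈ S, (setoidEntropy (s k) - setoidEntropy (t k)) := by
    apply Finset.sum_le_sum
    intro k hk
    have h3 := setoidEntropy_submodular (s k) (S.inf t) (t k)
    have h4 : S.inf t ≤ t k := Finset.inf_le hk
    rw [inf_assoc, inf_eq_left.2 h4, inf_eq_left.2 (h k)] at h3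
    linarith
  have h5 := h1.trans (add_le_add_right h2 _)
  rw [Finset.sum_sub_distrib] at h5
  linarith

end SetoidEntropy

/-! ### Assignment duality and the choice of back-offs. -/

section Duality

/-- Egerváry's theorem: a maximum weight permutation has an integral dual certificate. -/
lemma exists_dual_potentials {ι : Type*} [Fintype ι] [DecidableEq ι] (w : ι → ι → ℤ)
    (P : Equiv.Perm ι) (hP : ∀ Q : Equiv.Perm ι, ∑ j, w (Q j) j ≤ ∑ j, w (P j) j) :
    ∃ a b : ι → ℤ, (∀ i j, w i j ≤ a i + b j) ∧ ∀ j, w (P j) j = a (P j) + b j := by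
  -- Take feasible integer potentials of least total; the diagonal bounds the total below, and row
  -- sums of absolute values are feasible.
  obtain ⟨z, ⟨a, b, hab, hz⟩, hmin⟩ := Int.exists_least_of_bdd
    (P := fun z => ∃ a b : ι → ℤ, (∀ i j, w i j ≤ a i + b j) ∧ z = ∑ i, (a i + b i))
    ⟨∑ i, w i i, by
      rintro z ⟨a, b, hab, rfl⟩
      exact Finset.sum_le_sum fun i _ => hab i i⟩
    ⟨_, fun i => ∑ j, |w i j|, 0, fun i j => by
      have := Finset.single_le_sum (f := fun j => |w i j|) (fun j _ => abs_nonneg _)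
        (Finset.mem_univ j)
      have := le_abs_self (w i j)
      simp only [Pi.zero_apply]
      linarith, rfl⟩
  refine ⟨a, b, hab, ?_⟩
  -- Hall's condition for the graph of tight pairs. If `S` had fewer tight neighbours `N` than
  -- elements, lowering `a` by one on `S` and raising `b` by one on `N` would stay feasible, since
  -- slack is integral, and reduce the total.
  have hall : ∀ S : Finset ι,
      S.card ≤ (S.biUnion fun i => Finset.univ.filter fun j => w i j = a i + b j).card := by
    by_contra! hcon
    obtain ⟨S, hS⟩ := hcon
    set N := S.biUnion fun i => Finset.univ.filter fun j => w i j = a i + b j with hN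
    have := hmin (∑ i, ((a i - if i ∈ S then 1 else 0) + (b i + if i ∈ N then 1 else 0)))
      ⟨_, _, fun i j => ?_, rfl⟩
    · have h1 : ∑ i, ((a i - if i ∈ S then 1 else 0) + (b i + if i ∈ N then 1 else 0)) =
          ∑ i, (a i + b i) - (S.card : ℤ) + N.card := by
        simp only [Finset.sum_add_distrib, Finset.sum_sub_distrib]
        simp
        ring
      rw [h1] at this
      omega
    · have h1 := hab i j
      by_cases hi : i ∈ S
      · by_cases hj : j ∈ N
        · simp only [hi, hj, if_true]
          linarith
        · simp only [hi, hj, if_true, if_false]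
          have : w i j ≠ a i + b j := by
            intro h
            exact hj (Finset.mem_biUnion.2 ⟨i, hi, by simpa using h⟩)
          omega
      · simp only [hi, if_false]
        split_ifs <;> linarith
  obtain ⟨f, hf, hft⟩ := (Finset.all_card_le_biUnion_card_iff_exists_injective _).1 hall
  simp only [Finset.mem_filter, Finset.mem_univ, true_and] at hft
  let σ : Equiv.Perm ι := Equiv.ofBijective f (Finite.injective_iff_bijective.1 hf)
  have h1 : ∑ j, w (σ.symm j) j = ∑ i, (a i + b i) := by
    rw [← Equiv.sum_comp σ fun j => w (σ.symm j) j]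
    simp only [Equiv.symm_apply_apply]
    rw [Finset.sum_add_distrib, ← Equiv.sum_comp σ b, ← Finset.sum_add_distrib]
    exact Finset.sum_congr rfl fun i _ => hft i
  have h2 : ∑ j, (a (P j) + b j) = ∑ i, (a i + b i) := by
    rw [Finset.sum_add_distrib, Equiv.sum_comp P a, ← Finset.sum_add_distrib]
  have h3 := hP σ.symm
  -- The tight matching attains the dual value, so the maximal `P` does too, which forces equality
  -- in every term.
  have h4 : ∑ j, w (P j) j = ∑ j, (a (P j) + b j) :=
    le_antisymm (Finset.sum_le_sum fun j _ => hab _ _) (by rw [h2, ← h1]; exact h3)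
  intro j
  exact (Finset.sum_eq_sum_iff_of_le fun j _ => hab (P j) j).1 h4 j (Finset.mem_univ j)

/-- Back-offs `r` for which the interference power levels `a` at the receivers and the back-offs
add up to the weight of an optimal cyclic partition. -/
lemma exists_backoff {K : ℕ} {n : Fin K → Fin K → ℕ} (hn : TINOptimal n)
    {P : Equiv.Perm (Fin K)} (hP : IsOptimalPartition n P) :
    ∃ a r : Fin K → ℕ, (∀ i j, j ≠ i → n i j ≤ a i + r j) ∧
      (∀ i, a i = 0 ∨ ∃ j, j ≠ i ∧ n i j = a i + r j) ∧ (∀ i, a i + r i ≤ n i i) ∧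
      ∑ i, (a i + r i) = partitionWeight n P := by
  obtain ⟨a, b, hab, hPab⟩ := exists_dual_potentials (fun i j => (edgeWeight n i j : ℤ)) P
    (fun Q => by exact_mod_cast hP Q)
  rcases isEmpty_or_nonempty (Fin K) with hK | hK
  · exact ⟨0, 0, fun i => hK.elim i, fun i => hK.elim i, fun i => hK.elim i, by
      simp [partitionWeight]⟩
  -- Shifting by the least `b` makes `r` nonnegative with `r j₀ = 0`; then feasibility in column
  -- `j₀` makes `a'` nonnegative.
  obtain ⟨j₀, hj₀⟩ := Finite.exists_min b
  have ha : ∀ i, 0 ≤ a i + b j₀ := fun i => le_trans (by positivity) (hab i j₀)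
  choose a' ha' using fun i => Int.eq_ofNat_of_zero_le (ha i)
  choose r hr using fun j => Int.eq_ofNat_of_zero_le (sub_nonneg.2 (hj₀ j))
  have h1 : ∀ i j, edgeWeight n i j ≤ a' i + r j := by
    intro i j
    have := hab i j
    have := ha' i
    have := hr j
    zify
    linarith
  have h2 : ∀ j, edgeWeight n (P j) j = a' (P j) + r j := by
    intro j
    have := hPab j
    have := ha' (P j)
    have := hr j
    zify
    linarith
  have h2' : ∀ i, edgeWeight n i (P.symm i) = a' i + r (P.symm i) := by
    intro i
    have := h2 (P.symm i)
    rwa [Equiv.apply_symm_apply] at this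
  refine ⟨a', r, fun i j hij => ?_, fun i => ?_, fun i => ?_, ?_⟩
  · have := h1 i j
    rwa [edgeWeight, if_neg hij.symm] at this
  · have := h2' i
    by_cases hi : i = P.symm i
    · rw [edgeWeight, if_pos hi] at this
      left
      omega
    · rw [edgeWeight, if_neg hi] at this
      exact Or.inr ⟨_, fun h => hi h.symm, this⟩
  -- Tightness on the edges of `P` leaving and entering `i` bounds `r i` and `a' i` by the strongest
  -- outgoing and incoming cross strengths, whose sum TIN optimality controls. At a fixed point of
  -- `P` both vanish.
  · have e1 : r i ≤ (Finset.univ.erase i).sup fun j => n j i := by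
      have := h2 i
      by_cases hi : P i = i
      · rw [edgeWeight, if_pos hi] at this
        omega
      · rw [edgeWeight, if_neg hi] at this
        have h3 : n (P i) i ≤ _ := Finset.le_sup (f := fun j => n j i) (s := Finset.univ.erase i)
          (by simpa using hi)
        omega
    have e2 : a' i ≤ (Finset.univ.erase i).sup fun j => n i j := by
      have := h2' i
      by_cases hi : i = P.symm i
      · rw [edgeWeight, if_pos hi] at this
        omega
      · rw [edgeWeight, if_neg hi] at this
        have h3 : n i (P.symm i) ≤ _ := Finset.le_sup (f := fun j => n i j)
          (s := Finset.univ.erase i) (b := P.symm i)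
          (Finset.mem_erase.2 ⟨fun h => hi h.symm, Finset.mem_univ _⟩)
        omega
    have := hn i
    omega
  · rw [partitionWeight, Finset.sum_congr rfl fun j _ => h2 j, Finset.sum_add_distrib,
      Finset.sum_add_distrib, Equiv.sum_comp P a']

end Duality

/-! ### Zero-error uncoded transmission. -/

section Achievability

/-- At integer rates the ceiling is exact, so messages correspond bijectively to strings of `T * N`
bits. -/
lemma numMessages_natCast (T N : ℕ) : numMessages T (N : ℝ) = 2 ^ (T * N) := by
  unfold numMessages
  rw [← Nat.cast_mul, Real.rpow_natCast]
  exact_mod_cast Nat.ceil_natCast (R := ℝ) (2 ^ (T * N))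

lemma scaleFloor_eq_zero {s r p : ℕ} {X : Signal} (hX : ∀ b < r, X b = 0) (hp : s ≤ p + r) :
    scaleFloor s X p = 0 := by
  unfold scaleFloor
  split_ifs with h
  · exact hX _ (by omega)
  · rfl

/-- If Transmitter `j` is silent on its top `r j` levels, the interference at Receiver `i` stays
below level `a`, and the levels above carry the desired signal only. -/
lemma output_apply_of_le {K : ℕ} {n : Fin K → Fin K → ℕ} {r : Fin K → ℕ} {X : Fin K → Signal}
    (hX : ∀ j, ∀ b < r j, X j b = 0) {i : Fin K} {a p : ℕ}
    (ha : ∀ j, j ≠ i → n i j ≤ a + r j) (hp : a ≤ p) :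
    output n X i p = scaleFloor (n i i) (X i) p := by
  rw [output, Finset.sum_apply]
  apply Finset.sum_eq_single i
  · intro j _ hj
    exact scaleFloor_eq_zero (hX j) ((ha j hj).trans (by omega))
  · simp

/-- Sending uncoded bits between the interference level and the back-off level has no errors. -/
lemma achievable_of_backoff {K M : ℕ} (n : Fin M → Fin K → Fin K → ℕ) (a r : Fin M → Fin K → ℕ)
    (h1 : ∀ m i j, j ≠ i → n m i j ≤ a m i + r m j) (h2 : ∀ m i, a m i + r m i ≤ n m i i) :
    Achievable n fun i => ∑ m, ((n m i i : ℝ) - r m i - a m i) := by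
  have hR : (fun i => ∑ m, ((n m i i : ℝ) - r m i - a m i)) =
      fun i => ((∑ m, (n m i i - r m i - a m i) : ℕ) : ℝ) := by
    funext i
    rw [Nat.cast_sum]
    refine Finset.sum_congr rfl fun m _ => ?_
    have := h2 m i
    rw [Nat.cast_sub (by omega), Nat.cast_sub (by omega)]
  rw [hR]
  refine ⟨fun i => Nat.cast_nonneg _, ?_⟩
  have e : ∀ T i, Nonempty (Fin (numMessages T ((∑ m, (n m i i - r m i - a m i) : ℕ) : ℝ)) ≃
      (Fin T × (Σ m, Fin (n m i i - r m i - a m i)) → ZMod 2)) := by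
    intro T i
    refine ⟨Fintype.equivOfCardEq ?_⟩
    rw [numMessages_natCast]
    simp [ZMod.card]
  let φ := fun T i => (e T i).some
  let c : ∀ T, Code K M T fun i => ((∑ m, (n m i i - r m i - a m i) : ℕ) : ℝ) := fun T =>
    -- The bits used are `r ≤ b < n - a`. Bit `b` arrives at level `n - 1 - b`, which is at least
    -- `a` and hence free of interference.
    { enc := fun i w t m b => if h : r m i ≤ b ∧ b - r m i < n m i i - r m i - a m i then
        φ T i w (t, ⟨m, ⟨b - r m i, h.2⟩⟩) else 0
      dec := fun k y => (φ T k).symm fun x => y x.1 x.2.1 (n x.2.1 k k - 1 - (x.2.2 + r x.2.1 k)) }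
  refine ⟨c, fun k => ?_⟩
  have hdec : ∀ T w, (c T).dec k ((c T).received n w k) = w k := by
    intro T w
    rw [← (φ T k).symm_apply_apply (w k)]
    change (φ T k).symm _ = _
    congr 1
    funext ⟨t, m, l⟩
    have hl := l.2
    have ho := output_apply_of_le (n := n m) (r := r m) (X := fun i => (c T).enc i (w i) t m)
      (i := k) (a := a m k) (p := n m k k - 1 - (l + r m k))
      (fun j b hb => dif_neg fun h => absurd h.1 (by omega)) (h1 m k) (by omega)
    change output (n m) (fun i => (c T).enc i (w i) t m) k (n m k k - 1 - (l + r m k)) = _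
    rw [ho, scaleFloor, if_pos (by omega)]
    have hb : n m k k - 1 - (n m k k - 1 - (l + r m k)) = l + r m k := by omega
    rw [hb]
    change dite _ _ _ = _
    rw [dif_pos ⟨by omega, by omega⟩]
    simp
  have : ∀ T, (c T).errorProb n k = 0 := by
    intro T
    simp [Code.errorProb, hdec]
  simp [this]

end Achievability

/-! ### Evaluation of the TIN rates. -/

section TINRate

lemma entropy_eq_setoidEntropy {Ω α : Type*} [Fintype Ω] (f : Ω → α) :
    entropy f = setoidEntropy (Setoid.ker f) := by
  classical
  rcases isEmpty_or_nonempty Ω with hΩ | hΩ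
  · simp [entropy, setoidEntropy]
  have hΩ : (Fintype.card Ω : ℝ) ≠ 0 := by exact_mod_cast Fintype.card_ne_zero
  unfold setoidEntropy entropy
  rw [← Finset.sum_fiberwise_of_maps_to (s := Finset.univ) (t := Finset.univ.image f) (g := f)
    (fun ω _ => Finset.mem_image_of_mem f (Finset.mem_univ ω)), Finset.sum_div]
  refine Finset.sum_congr (by congr!) fun y hy => ?_
  have hc : ∀ ω ∈ Finset.univ.filter (fun ω => f ω = y), classCard (Setoid.ker f) ω =
      (Finset.univ.filter (fun ω => f ω = y)).card := by
    intro ω hω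
    simp only [Finset.mem_filter, Finset.mem_univ, true_and] at hω
    simp only [classCard, Setoid.ker_def, hω, eq_comm]
  obtain ⟨ω, -, rfl⟩ := Finset.mem_image.1 hy
  have hN : ((Finset.univ.filter (fun ω' => f ω' = f ω)).card : ℝ) ≠ 0 := by
    exact_mod_cast (Finset.card_pos.2 ⟨ω, by simp⟩).ne'
  rw [Finset.sum_congr rfl fun ω' hω' => by rw [hc ω' hω'], Finset.sum_const, nsmul_eq_mul,
    Real.negMulLog, Real.logb, Real.logb]
  have : Real.log (((Finset.univ.filter (fun ω' => f ω' = f ω)).card : ℝ) / Fintype.card Ω) =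
      Real.log (Finset.univ.filter (fun ω' => f ω' = f ω)).card - Real.log (Fintype.card Ω) :=
    Real.log_div hN hΩ
  convert_to (-(((Finset.univ.filter (fun ω' => f ω' = f ω)).card : ℝ) / Fintype.card Ω) *
    Real.log (((Finset.univ.filter (fun ω' => f ω' = f ω)).card : ℝ) / Fintype.card Ω)) /
      Real.log 2 = _
  rw [this]
  ring

/-- A function of uniform bits that determines and is determined by the values of a surjective
linear map onto `ι → ZMod 2` has entropy `Fintype.card ι`. -/
lemma entropy_eq_card_bits {Ω α ι : Type*} [AddCommGroup Ω] [Fintype Ω] [Fintype ι] (f : Ω → α)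
    (e : Ω →+ (ι → ZMod 2)) (he : Function.Surjective e)
    (h : ∀ ω ω', f ω = f ω' ↔ e ω = e ω') : entropy f = Fintype.card ι := by
  classical
  have hker : Setoid.ker f = Setoid.ker e := Setoid.ext fun ω ω' => h ω ω'
  rw [entropy_eq_setoidEntropy, hker,
    setoidEntropy_eq_of_classCard_mul (N := 2 ^ Fintype.card ι)]
  · simp [Real.logb_pow]
  · intro ω
    have h1 : ∀ y, (Finset.univ.filter fun ω' => e ω' = y).card = classCard (Setoid.ker e) ω := by
      intro y
      rw [AddMonoidHom.card_fiber_eq_of_mem_range e (he y) ⟨ω, rfl⟩]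
      simp only [classCard, Setoid.ker_def, eq_comm]
    have h2 := Finset.card_eq_sum_card_fiberwise (f := e) (s := Finset.univ) (t := Finset.univ)
      (fun _ _ => Finset.mem_univ _)
    rw [Finset.sum_congr rfl fun y _ => h1 y, Finset.sum_const, Finset.card_univ,
      Finset.card_univ, smul_eq_mul] at h2
    rw [h2, mul_comm]
    simp [ZMod.card]

lemma scaleFloor_add (s : ℕ) (X Y : Signal) :
    scaleFloor s (X + Y) = scaleFloor s X + scaleFloor s Y := by
  funext p
  simp only [scaleFloor, Pi.add_apply]
  split_ifs <;> simp

lemma tinInput_add {K : ℕ} (q : ℕ) (r : Fin K → ℕ) (ω ω' : Fin K → Fin q → ZMod 2) (i : Fin K) :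
    tinInput q r (ω + ω') i = tinInput q r ω i + tinInput q r ω' i := by
  funext b
  simp only [tinInput, Pi.add_apply]
  split_ifs <;> simp

lemma tinInput_zero {K : ℕ} (q : ℕ) (r : Fin K → ℕ) (i : Fin K) :
    tinInput q r 0 i = 0 := by
  funext b
  simp [tinInput]

lemma scaleFloor_zero (s : ℕ) : scaleFloor s 0 = 0 := by
  funext p
  simp [scaleFloor]

lemma tinInput_eq_zero {K q : ℕ} {r : Fin K → ℕ} (ω : Fin K → Fin q → ZMod 2) (j : Fin K)
    {b : ℕ} (hb : b < r j) : tinInput q r ω j b = 0 := by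
  simp [tinInput, hb]

lemma le_maxStrength {K : ℕ} (n : Fin K → Fin K → ℕ) (i j : Fin K) : n i j ≤ maxStrength n :=
  (Finset.le_sup (f := n i) (Finset.mem_univ j)).trans
    (Finset.le_sup (f := fun k => Finset.univ.sup (n k)) (Finset.mem_univ i))

/-- A choice of the bits for which the signal of Transmitter `j` alone produces the prescribed
bits `y` on the levels below `L` of Receiver `i`. -/
lemma exists_bits_scaleFloor {q s L ρ : ℕ} (hs : s ≤ q) (hL : L + ρ ≤ s) (y : Fin L → ZMod 2) :
    ∃ x : Fin q → ZMod 2, ∀ p : Fin L, ∃ h : s - 1 - p < q, ρ ≤ s - 1 - p ∧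
      x ⟨s - 1 - p, h⟩ = y p := by
  refine ⟨fun b => if h : s - 1 - b < L then y ⟨s - 1 - b, h⟩ else 0, fun p => ?_⟩
  have hp := p.2
  refine ⟨by omega, by omega, ?_⟩
  have : s - 1 - (s - 1 - (p : ℕ)) = p := by omega
  simp [this]

lemma scaleFloor_tinInput {K q s : ℕ} (r : Fin K → ℕ) (ω : Fin K → Fin q → ZMod 2) (j : Fin K)
    {p : ℕ} (hp : p < s) (h : s - 1 - p < q) (hr : r j ≤ s - 1 - p) :
    scaleFloor s (tinInput q r ω j) p = ω j ⟨s - 1 - p, h⟩ := by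
  simp [scaleFloor, hp, tinInput, h, hr]

lemma tinInput_of_eq_zero {K q : ℕ} (r : Fin K → ℕ) {ω : Fin K → Fin q → ZMod 2} {j : Fin K}
    (h : ω j = 0) : tinInput q r ω j = 0 := by
  funext b
  simp [tinInput, h]

/-- All variables are linear in the uniform bits, so each entropy is a rank: `q - r i` for the
input, `n i i - r i` for the output, and `q - r i + a` for the pair. Given the input, the output
reveals just the interference, which by `h1` stays below level `a` and by `h2` takes every value
there. -/
lemma tinRate_eq {K : ℕ} {n : Fin K → Fin K → ℕ} {r : Fin K → ℕ} {i : Fin K} {a : ℕ}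
    (h1 : ∀ j, j ≠ i → n i j ≤ a + r j) (h2 : a = 0 ∨ ∃ j, j ≠ i ∧ n i j = a + r j)
    (h3 : a + r i ≤ n i i) : tinRate n r i = (n i i : ℝ) - r i - a := by
  classical
  set q := maxStrength n with hq
  have hq' := le_maxStrength n i
  have hri : r i ≤ q := (Nat.le_add_left _ _).trans (h3.trans (hq' i))
  let S := {b : Fin q // r i ≤ b}
  have hS : Fintype.card S = q - r i := by
    rw [Fintype.card_subtype]
    have : Finset.univ.filter (fun b : Fin q => r i ≤ b) =
        (Finset.univ.filter (fun b : Fin q => (b : ℕ) < r i))ᶜ := by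
      ext; simp
    rw [this, Finset.card_compl, Fin.card_filter_val_lt]
    simp [hri]
  have hXiff : ∀ ω ω' : Fin K → Fin q → ZMod 2, tinInput q r ω i = tinInput q r ω' i ↔
      ∀ b : S, ω i b.1 = ω' i b.1 := by
    intro ω ω'
    constructor
    · intro h b
      have := congrFun h b.1
      simpa [tinInput, b.2] using this
    · intro h
      funext b
      simp only [tinInput]
      split_ifs with hb hr
      · exact h ⟨⟨b, hb⟩, hr⟩
      · rfl
      · rfl
  have hX : entropy (fun ω : Fin K → Fin q → ZMod 2 => tinInput q r ω i) = q - r i := by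
    rw [entropy_eq_card_bits (ι := S) _
      ⟨⟨fun ω b => ω i b.1, rfl⟩, fun ω ω' => rfl⟩, hS, Nat.cast_sub hri]
    · intro y
      refine ⟨fun j b => if h : r i ≤ b then y ⟨b, h⟩ else 0, ?_⟩
      funext b
      simp [b.2]
    · intro ω ω'
      rw [hXiff]
      exact funext_iff.symm
  have hY : entropy (fun ω : Fin K → Fin q → ZMod 2 => output n (tinInput q r ω) i) =
      (n i i : ℝ) - r i := by
    rw [entropy_eq_card_bits (ι := Fin (n i i - r i)) _
      ⟨⟨fun ω p => output n (tinInput q r ω) i p, ?_⟩, fun ω ω' => ?_⟩, Fintype.card_fin,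
      Nat.cast_sub (by omega)]
    · intro y
      -- The desired signal alone already reaches every output.
      obtain ⟨x, hx⟩ := exists_bits_scaleFloor (hq' i) (by omega : n i i - r i + r i ≤ n i i) y
      refine ⟨Pi.single i x, ?_⟩
      funext p
      change output n _ i p = y p
      obtain ⟨hp, hr, hxy⟩ := hx p
      rw [output, Finset.sum_apply, Finset.sum_eq_single i]
      · rw [scaleFloor_tinInput r _ i (by omega) hp hr, Pi.single_eq_same, hxy]
      · intro j _ hj
        rw [tinInput_of_eq_zero r (Pi.single_eq_of_ne hj x), scaleFloor_zero]
        rfl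
      · simp
    · intro ω ω'
      change _ ↔ (fun p : Fin (n i i - r i) => output n (tinInput q r ω) i p) =
        fun p : Fin (n i i - r i) => output n (tinInput q r ω') i p
      constructor
      · intro h
        rw [h]
      · intro h
        funext p
        by_cases hp : p < n i i - r i
        · exact congrFun h ⟨p, hp⟩
        -- From level `n i i - r i` upward the desired signal is silenced, and by `h3` the
        -- interference lies lower still.
        · have hz : ∀ ω : Fin K → Fin q → ZMod 2, output n (tinInput q r ω) i p = 0 := by
            intro ω
            rw [output_apply_of_le (fun j b hb => tinInput_eq_zero ω j hb) h1 (by omega)]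
            exact scaleFloor_eq_zero (fun b hb => tinInput_eq_zero ω i hb) (by omega)
          rw [hz, hz]
    · funext p
      simp [output, tinInput_zero, scaleFloor_zero]
    · funext p
      simp [output, tinInput_add, scaleFloor_add, Finset.sum_add_distrib]
  have hXY : entropy (fun ω : Fin K → Fin q → ZMod 2 =>
      (tinInput q r ω i, output n (tinInput q r ω) i)) = (q : ℝ) - r i + a := by
    have hsplit : ∀ (ω : Fin K → Fin q → ZMod 2) (p : ℕ), output n (tinInput q r ω) i p =
        scaleFloor (n i i) (tinInput q r ω i) p +
          ∑ j ∈ Finset.univ.erase i, scaleFloor (n i j) (tinInput q r ω j) p := by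
      intro ω p
      rw [output, Finset.sum_apply]
      exact (Finset.add_sum_erase _ _ (Finset.mem_univ i)).symm
    rw [entropy_eq_card_bits (ι := S ⊕ Fin a) _
      ⟨⟨fun ω => Sum.elim (fun b => ω i b.1)
        (fun p => ∑ j ∈ Finset.univ.erase i, scaleFloor (n i j) (tinInput q r ω j) p), ?_⟩,
        fun ω ω' => ?_⟩, Fintype.card_sum, hS, Fintype.card_fin, Nat.cast_add, Nat.cast_sub hri]
    · intro y
      obtain ⟨ω, hωi, hω⟩ : ∃ ω : Fin K → Fin q → ZMod 2,
          (ω i = fun b : Fin q => if h : r i ≤ b then y (Sum.inl ⟨b, h⟩) else 0) ∧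
          ∀ p : Fin a, ∑ j ∈ Finset.univ.erase i,
            scaleFloor (n i j) (tinInput q r ω j) p = y (Sum.inr p) := by
        -- The tight interferer `j₀` alone produces any pattern on the `a` levels; all other
        -- interferers are set to zero.
        rcases h2 with rfl | ⟨j₀, hj₀, hnj⟩
        · exact ⟨fun _ (b : Fin q) => if h : r i ≤ b then y (Sum.inl ⟨b, h⟩) else 0, rfl,
            fun p => p.elim0⟩
        · obtain ⟨x, hx⟩ := exists_bits_scaleFloor (hq' j₀) hnj.ge fun p => y (Sum.inr p)
          refine ⟨Function.update (Pi.single j₀ x) i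
            fun b : Fin q => if h : r i ≤ b then y (Sum.inl ⟨b, h⟩) else 0, by simp, fun p => ?_⟩
          obtain ⟨hp, hr, hxy⟩ := hx p
          rw [Finset.sum_eq_single j₀]
          · rw [scaleFloor_tinInput r _ j₀ (by omega) hp hr, Function.update_of_ne hj₀,
              Pi.single_eq_same, hxy]
          · intro j hj hjj
            rw [tinInput_of_eq_zero r, scaleFloor_zero]
            · rfl
            · rw [Function.update_of_ne (Finset.ne_of_mem_erase hj), Pi.single_eq_of_ne hjj]
          · intro h
            exact absurd (Finset.mem_erase.2 ⟨hj₀, Finset.mem_univ _⟩) h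
      refine ⟨ω, ?_⟩
      funext x
      rcases x with b | p
      · change ω i b.1 = _
        simp [hωi, b.2]
      · exact hω p
    · intro ω ω'
      change _ ↔ Sum.elim (fun b : S => ω i b.1) (fun p : Fin a => ∑ j ∈ Finset.univ.erase i,
          scaleFloor (n i j) (tinInput q r ω j) p) =
        Sum.elim (fun b : S => ω' i b.1) (fun p : Fin a => ∑ j ∈ Finset.univ.erase i,
          scaleFloor (n i j) (tinInput q r ω' j) p)
      rw [Prod.mk.injEq, Sum.elim_eq_iff, hXiff, ← funext_iff (f := fun b : S => ω i b.1)]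
      refine and_congr_right fun hb => ?_
      have hXX : tinInput q r ω i = tinInput q r ω' i := (hXiff ω ω').2 (congrFun hb)
      constructor
      · intro h
        funext p
        have := congrFun h p
        rw [hsplit, hsplit, hXX] at this
        exact add_left_cancel this
      · intro h
        funext p
        by_cases hp : p < a
        · rw [hsplit, hsplit, hXX]
          exact congrArg _ (congrFun h ⟨p, hp⟩)
        · rw [output_apply_of_le (fun j b hb => tinInput_eq_zero ω j hb) h1 (not_lt.1 hp),
            output_apply_of_le (fun j b hb => tinInput_eq_zero ω' j hb) h1 (not_lt.1 hp), hXX]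
    · funext x
      rcases x with b | p <;> simp [tinInput_zero, scaleFloor_zero]
    · funext x
      rcases x with b | p <;> simp [tinInput_add, scaleFloor_add, Finset.sum_add_distrib]
  rw [tinRate, mutualInfo, hX, hY, hXY]
  ring

end TINRate

/-! ### The converse through invertibility. -/

section Converse

/-- The information inequality behind the converse: `W k` are the messages, `I k` the
interference at Receiver `k`, `V k` and `Z k` side information and remaining output levels from
which Receiver `k` finds `W k` and `I k`. The interference at all receivers and `D` determine all
`V k`. -/
lemma sum_setoidEntropy_messages_le {Ω ι : Type*} [Fintype Ω] [Fintype ι] [DecidableEq ι]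
    {W I V Z : ι → Setoid Ω} {D : Setoid Ω} {δ : ℝ} (hW : Finset.univ.inf W = ⊥)
    (hWV : ∀ k, W k ≤ V k) (hI : ∀ k, (Finset.univ.erase k).inf W ≤ I k)
    (hdec : ∀ k, V k ⊓ Z k ≤ W k ⊓ I k) (hinv : Finset.univ.inf I ⊓ D ≤ Finset.univ.inf V)
    (hδ : ∑ k, setoidEntropy (W k) ≤ setoidEntropy (⊥ : Setoid Ω) + δ) :
    ∑ k, setoidEntropy (W k) ≤
      ∑ k, setoidEntropy (Z k) + setoidEntropy D + (Fintype.card ι + 1) * δ := by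
  have h1 : ∀ k, setoidEntropy (W k) + setoidEntropy (I k) ≤
      setoidEntropy (V k) + setoidEntropy (Z k) + δ := by
    intro k
    -- `I k` depends on the other messages only, which are independent of `W k` up to `δ`; hence the
    -- joint entropy of `W k` and `I k` is at least the sum of theirs minus `δ`.
    have e1 := setoidEntropy_submodular (W k) ((Finset.univ.erase k).inf W) (I k)
    have e2 : W k ⊓ (Finset.univ.erase k).inf W = ⊥ := by
      rw [← Finset.inf_insert, Finset.insert_erase (Finset.mem_univ k), hW]
    rw [e2, inf_eq_left.2 (hI k), bot_inf_eq] at e1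
    have e3 := setoidEntropy_finset_inf_le_sum (Finset.univ.erase k) W
    have e4 := Finset.add_sum_erase Finset.univ (fun k => setoidEntropy (W k)) (Finset.mem_univ k)
    have e5 := (setoidEntropy_anti (hdec k)).trans (setoidEntropy_inf_le (V k) (Z k))
    linarith
  have h2 := Finset.sum_le_sum fun k (_ : k ∈ Finset.univ) => h1 k
  simp only [Finset.sum_add_distrib, Finset.sum_const, Finset.card_univ, nsmul_eq_mul] at h2
  -- The `V k` are functions of the separate messages, so they are also independent up to `δ`. With
  -- `h4` and `h5` the interference entropies cancel against those in `h2`.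
  have h3 := sum_setoidEntropy_sub_inf_le Finset.univ W V hWV
  rw [hW] at h3
  have h4 := (setoidEntropy_anti hinv).trans (setoidEntropy_finset_inf_le Finset.univ I D)
  have h5 : ∑ k, (setoidEntropy (I k ⊓ D) - setoidEntropy D) ≤ ∑ k, setoidEntropy (I k) :=
    Finset.sum_le_sum fun k _ => by linarith [setoidEntropy_inf_le (I k) D]
  linarith

/-- The number of levels of Transmitter `k` that are seen at some other receiver. -/
def interferingLevels {K : ℕ} (n : Fin K → Fin K → ℕ) (k : Fin K) : ℕ :=
  (Finset.univ.erase k).sup fun j => n j k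

lemma le_interferingLevels {K : ℕ} (n : Fin K → Fin K → ℕ) {j k : Fin K} (h : j ≠ k) :
    n j k ≤ interferingLevels n k :=
  Finset.le_sup (f := fun j => n j k) (Finset.mem_erase.2 ⟨h, Finset.mem_univ j⟩)

lemma edgeWeight_le_interferingLevels {K : ℕ} (n : Fin K → Fin K → ℕ) (j k : Fin K) :
    edgeWeight n j k ≤ interferingLevels n k := by
  unfold edgeWeight
  split_ifs with h
  · exact Nat.zero_le _
  · exact le_interferingLevels n h

lemma TINOptimal.add_le {K : ℕ} {n : Fin K → Fin K → ℕ} (hn : TINOptimal n) {k i : Fin K}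
    (h : i ≠ k) : interferingLevels n k + n k i ≤ n k k :=
  (Nat.add_le_add_left (Finset.le_sup (f := fun i => n k i)
    (Finset.mem_erase.2 ⟨h, Finset.mem_univ i⟩)) _).trans (hn k)

lemma TINOptimal.interferingLevels_le {K : ℕ} {n : Fin K → Fin K → ℕ} (hn : TINOptimal n)
    (k : Fin K) : interferingLevels n k ≤ n k k :=
  (Nat.le_add_right _ _).trans (hn k)

/-- The interference at Receiver `k`. -/
def interference {K : ℕ} (n : Fin K → Fin K → ℕ) (X : Fin K → Signal) (k : Fin K) : Signal :=
  ∑ i ∈ Finset.univ.erase k, scaleFloor (n k i) (X i)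

lemma output_eq_add_interference {K : ℕ} (n : Fin K → Fin K → ℕ) (X : Fin K → Signal)
    (k : Fin K) : output n X k = scaleFloor (n k k) (X k) + interference n X k :=
  (Finset.add_sum_erase _ _ (Finset.mem_univ k)).symm

/-- TIN optimality in the form `n k i ≤ n k k - interferingLevels n k`: interference never reaches
the levels on which the top `interferingLevels n k` bits of the desired signal arrive. -/
lemma interference_apply_eq_zero {K : ℕ} {n : Fin K → Fin K → ℕ} (hn : TINOptimal n)
    (X : Fin K → Signal) {k : Fin K} {p : ℕ} (hp : n k k - interferingLevels n k ≤ p) :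
    interference n X k p = 0 := by
  rw [interference, Finset.sum_apply]
  refine Finset.sum_eq_zero fun i hi => ?_
  have := hn.add_le (Finset.ne_of_mem_erase hi)
  exact scaleFloor_eq_zero (r := 0) (by simp) (by omega)

/-- On an invertible sub-channel, the interference and the non-participating interfering levels
determine all interfering levels. -/
lemma interfering_eq_of_interference_eq {K : ℕ} {n : Fin K → Fin K → ℕ} {P : Equiv.Perm (Fin K)}
    (hinv : ∀ X X' : Fin K → Signal, participatingOutput n P X = participatingOutput n P X' →
      participatingInput n P X = participatingInput n P X') {X X' : Fin K → Signal}
    (hI : ∀ k, interference n X k = interference n X' k)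
    (hD : ∀ k b, edgeWeight n (P k) k ≤ b → b < interferingLevels n k → X k b = X' k b)
    (k : Fin K) {b : ℕ} (hb : b < interferingLevels n k) : X k b = X' k b := by
  -- The non-participating bits agree by `hD`, so they drop out of the difference of the
  -- interferences.
  have key : ∀ k, participatingOutput n P X k - participatingOutput n P X' k =
      interference n X k - interference n X' k := by
    intro k
    simp only [participatingOutput, interference, ← Finset.sum_sub_distrib]
    refine Finset.sum_congr rfl fun i hi => ?_
    funext p
    simp only [Pi.sub_apply, scaleFloor, participatingInput]
    split_ifs with h1 h2
    · rfl
    · have := le_interferingLevels n (Finset.ne_of_mem_erase hi).symm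
      rw [hD i _ (not_lt.1 h2) (by omega)]
      simp
    · rfl
  have hout : participatingOutput n P X = participatingOutput n P X' := by
    funext k
    rw [← sub_eq_zero, key, hI, sub_self]
  by_cases h : b < edgeWeight n (P k) k
  · have := congrFun (congrFun (hinv X X' hout) k) b
    simpa [participatingInput, h] using this
  · exact hD k b (not_lt.1 h) hb

/-- The top interfering levels of the desired signal and the low levels of the output determine
the output. -/
lemma output_eq_of_levels_eq {K : ℕ} {n : Fin K → Fin K → ℕ} (hn : TINOptimal n)
    {X X' : Fin K → Signal} {k : Fin K} (hV : ∀ b < interferingLevels n k, X k b = X' k b)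
    (hZ : ∀ p < n k k - interferingLevels n k, output n X k p = output n X' k p) :
    output n X k = output n X' k := by
  funext p
  by_cases hp : p < n k k - interferingLevels n k
  · exact hZ p hp
  · rw [output_eq_add_interference, output_eq_add_interference, Pi.add_apply, Pi.add_apply,
      interference_apply_eq_zero hn X (not_lt.1 hp), interference_apply_eq_zero hn X' (not_lt.1 hp)]
    simp only [scaleFloor]
    split_ifs with h
    · rw [hV _ (by omega)]
    · rfl

/-- The message tuples that all receivers decode correctly. -/
abbrev Code.Good {K M T : ℕ} {R : Fin K → ℝ} (c : Code K M T R)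
    (n : Fin M → Fin K → Fin K → ℕ) : Type :=
  {w : ∀ i, Fin (numMessages T (R i)) // ∀ k, c.dec k (c.received n w k) = w k}

lemma numMessages_pos (T : ℕ) (R : ℝ) : 0 < numMessages T R :=
  Nat.ceil_pos.2 (by positivity)

/-- Instance of `sum_setoidEntropy_messages_le` on the correctly decoded tuples. The constant is `(K
+ 1) * δ` with `δ = 1`, plus one further bit for passing from all message tuples to the good ones.
-/
lemma Code.sum_logb_numMessages_le {K M T : ℕ} {R : Fin K → ℝ} (c : Code K M T R)
    {n : Fin M → Fin K → Fin K → ℕ} (hTIN : ∀ m, TINOptimal (n m)) {P : Fin M → Equiv.Perm (Fin K)}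
    (hinv : ∀ m, ∀ X X' : Fin K → Signal,
      participatingOutput (n m) (P m) X = participatingOutput (n m) (P m) X' →
        participatingInput (n m) (P m) X = participatingInput (n m) (P m) X')
    (hgood : Fintype.card (∀ i, Fin (numMessages T (R i))) ≤ 2 * Fintype.card (c.Good n)) :
    ∑ k, Real.logb 2 (numMessages T (R k)) ≤
      T * ∑ m, ((∑ i, (n m i i : ℝ)) - partitionWeight (n m) (P m)) + (K + 2) := by
  classical
  have hpos : ∀ k, 0 < numMessages T (R k) := fun k => numMessages_pos T (R k)
  have : ∀ k, Nonempty (Fin (numMessages T (R k))) := fun k => ⟨⟨0, hpos k⟩⟩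
  have hcardpos : 0 < Fintype.card (∀ i, Fin (numMessages T (R i))) := Fintype.card_pos
  have : Nonempty (c.Good n) := Fintype.card_pos_iff.1 (by omega)
  let X : c.Good n → Fin T → Fin M → Fin K → Signal := fun w t m i => c.enc i (w.1 i) t m
  let W : Fin K → Setoid (c.Good n) := fun k => Setoid.ker fun w => w.1 k
  let I : Fin K → Setoid (c.Good n) := fun k => Setoid.ker fun w t m =>
    interference (n m) (X w t m) k
  let V : Fin K → Setoid (c.Good n) := fun k => Setoid.ker fun w t m
    (b : Fin (interferingLevels (n m) k)) => X w t m k b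
  let zbits : ∀ k, c.Good n →
      Fin T × (Σ m, Fin (n m k k - interferingLevels (n m) k)) → ZMod 2 :=
    fun k w x => output (n x.2.1) (X w x.1 x.2.1) k x.2.2
  let dbits : c.Good n → Fin T × (Σ m, Σ k, Fin (interferingLevels (n m) k -
      edgeWeight (n m) (P m k) k)) → ZMod 2 :=
    fun w x => X w x.1 x.2.1 x.2.2.1 (edgeWeight (n x.2.1) (P x.2.1 x.2.2.1) x.2.2.1 + x.2.2.2)
  have hWbot : Finset.univ.inf W = ⊥ := by
    refine le_bot_iff.1 fun w w' h => ?_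
    have h' : ∀ k, w.1 k = w'.1 k := fun k =>
      (Finset.inf_le (f := W) (Finset.mem_univ k) : _ ≤ _) h
    exact Subtype.ext (funext h')
  have hlogW : ∀ k, setoidEntropy (W k) ≤ Real.logb 2 (numMessages T (R k)) := by
    intro k
    simpa using setoidEntropy_ker_le_logb_card fun w : c.Good n => w.1 k
  -- Keeping at least half of the tuples costs at most one bit of joint entropy.
  have hbot : ∑ k, Real.logb 2 (numMessages T (R k)) ≤
      setoidEntropy (⊥ : Setoid (c.Good n)) + 1 := by
    rw [setoidEntropy_bot, ← Real.logb_prod _ _ fun k _ => by exact_mod_cast (hpos k).ne']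
    have hG : (0 : ℝ) < Fintype.card (c.Good n) := by exact_mod_cast Fintype.card_pos
    have h2 : Real.logb 2 (2 * Fintype.card (c.Good n)) =
        Real.logb 2 (Fintype.card (c.Good n)) + 1 := by
      rw [Real.logb_mul two_ne_zero hG.ne', Real.logb_self_eq_one one_lt_two, add_comm]
    rw [← h2]
    refine Real.logb_le_logb_of_le one_lt_two ?_ ?_
    · exact Finset.prod_pos fun k _ => by exact_mod_cast hpos k
    · have : ((Fintype.card (∀ i, Fin (numMessages T (R i))) : ℕ) : ℝ) ≤
          2 * Fintype.card (c.Good n) := by exact_mod_cast hgood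
      simpa using this
  have main := sum_setoidEntropy_messages_le (W := W) (I := I) (V := V)
    (Z := fun k => Setoid.ker (zbits k)) (D := Setoid.ker dbits) (δ := 1) hWbot
    (fun k w w' h => ?_) (fun k w w' h => ?_) (fun k w w' h => ?_) (fun w w' h => ?_)
    ((Finset.sum_le_sum fun k _ => hlogW k).trans hbot)
  · have hZ : ∀ k, setoidEntropy (Setoid.ker (zbits k)) ≤
        T * ∑ m, ((n m k k : ℝ) - interferingLevels (n m) k) := by
      intro k
      refine (setoidEntropy_le_card_bits (zbits k) le_rfl).trans (le_of_eq ?_)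
      simp only [Fintype.card_prod, Fintype.card_sigma, Fintype.card_fin, Nat.cast_mul,
        Nat.cast_sum]
      congr 1
      exact Finset.sum_congr rfl fun m _ => Nat.cast_sub ((hTIN m).interferingLevels_le k)
    have hD : setoidEntropy (Setoid.ker dbits) ≤
        T * ∑ m, ∑ k, ((interferingLevels (n m) k : ℝ) - edgeWeight (n m) (P m k) k) := by
      refine (setoidEntropy_le_card_bits dbits le_rfl).trans (le_of_eq ?_)
      simp only [Fintype.card_prod, Fintype.card_sigma, Fintype.card_fin, Nat.cast_mul,
        Nat.cast_sum]
      congr 1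
      exact Finset.sum_congr rfl fun m _ => Finset.sum_congr rfl fun k _ =>
        Nat.cast_sub (edgeWeight_le_interferingLevels (n m) _ k)
    have hZs := Finset.sum_le_sum fun k (_ : k ∈ Finset.univ) => hZ k
    rw [← Finset.mul_sum, Finset.sum_comm] at hZs
    have hsub := setoidEntropy_finset_inf_le_sum Finset.univ W
    rw [hWbot] at hsub
    -- The bits counted by `zbits` and `dbits` add up to the partition bound, as the interfering
    -- levels cancel.
    have hsum : (T : ℝ) * ∑ m, ((∑ i, (n m i i : ℝ)) - partitionWeight (n m) (P m)) =
        T * ∑ m, ∑ k, ((n m k k : ℝ) - interferingLevels (n m) k) +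
        T * ∑ m, ∑ k, ((interferingLevels (n m) k : ℝ) - edgeWeight (n m) (P m k) k) := by
      rw [← mul_add, ← Finset.sum_add_distrib]
      congr 1
      refine Finset.sum_congr rfl fun m _ => ?_
      rw [partitionWeight, Nat.cast_sum]
      simp only [Finset.sum_sub_distrib]
      ring
    rw [Fintype.card_fin] at main
    rw [hsum]
    linarith
  · have h' : w.1 k = w'.1 k := h
    funext t m b
    simp only [X, h']
  · have h' : ∀ i ∈ Finset.univ.erase k, w.1 i = w'.1 i := fun i hi =>
      (Finset.inf_le (f := W) hi : _ ≤ _) h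
    funext t m
    exact Finset.sum_congr rfl fun i hi => by simp only [X, h' i hi]
  -- Side information and low levels give the output, correct decoding gives the message, and
  -- subtracting the desired signal leaves the interference.
  · obtain ⟨hV, hZ⟩ := h
    have hY : c.received n w.1 k = c.received n w'.1 k := by
      funext t m
      exact output_eq_of_levels_eq (hTIN m)
        (fun b hb => congrFun (congrFun (congrFun hV t) m) ⟨b, hb⟩)
        (fun p hp => congrFun hZ (t, ⟨m, ⟨p, hp⟩⟩))
    have hw : w.1 k = w'.1 k := by rw [← w.2 k, ← w'.2 k, hY]
    refine ⟨hw, ?_⟩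
    funext t m
    have h1 : output (n m) (X w t m) k = output (n m) (X w' t m) k := congrFun (congrFun hY t) m
    rw [output_eq_add_interference, output_eq_add_interference] at h1
    have h2 : X w t m k = X w' t m k := by simp only [X, hw]
    rw [h2] at h1
    exact add_left_cancel h1
  · obtain ⟨hI, hD⟩ := h
    have hI' : ∀ k t m, interference (n m) (X w t m) k = interference (n m) (X w' t m) k := by
      intro k t m
      have h' : I k w w' := (Finset.inf_le (f := I) (Finset.mem_univ k) : _ ≤ _) hI
      exact congrFun (congrFun h' t) m
    have hle : (Setoid.ker fun w t m k (b : Fin (interferingLevels (n m) k)) => X w t m k b) ≤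
        Finset.univ.inf V := by
      refine Finset.le_inf fun k _ w w' h => ?_
      funext t m
      exact congrFun (congrFun (congrFun h t) m) k
    apply hle
    funext t m k b
    refine interfering_eq_of_interference_eq (hinv m) (fun k => hI' k t m)
      (fun k b h1 h2 => ?_) k b.2
    have := congrFun hD (t, ⟨m, ⟨k, ⟨b - edgeWeight (n m) (P m k) k, by omega⟩⟩⟩)
    simpa [dbits, Nat.add_sub_cancel' h1] using this

/-- If the error probabilities are small, all receivers decode most message tuples correctly. -/
lemma Code.card_le_two_mul_card_good {K M T : ℕ} {R : Fin K → ℝ} (c : Code K M T R)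
    {n : Fin M → Fin K → Fin K → ℕ} (h : ∀ k, c.errorProb n k ≤ 1 / (2 * (K + 1))) :
    Fintype.card (∀ i, Fin (numMessages T (R i))) ≤ 2 * Fintype.card (c.Good n) := by
  classical
  have : ∀ k, Nonempty (Fin (numMessages T (R k))) := fun k => ⟨⟨0, numMessages_pos T (R k)⟩⟩
  set N := Fintype.card (∀ i, Fin (numMessages T (R i))) with hN
  have hNpos : (0 : ℝ) < N := by exact_mod_cast (Fintype.card_pos : 0 < N)
  have hbad : Fintype.card {w : ∀ i, Fin (numMessages T (R i)) //
      ¬ ∀ k, c.dec k (c.received n w k) = w k} ≤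
      ∑ k, (Finset.univ.filter fun w => c.dec k (c.received n w k) ≠ w k).card := by
    rw [Fintype.card_subtype]
    refine (Finset.card_le_card ?_).trans Finset.card_biUnion_le
    intro w hw
    simpa using hw
  have hsplit := Fintype.card_subtype_compl fun w : ∀ i, Fin (numMessages T (R i)) =>
    ∀ k, c.dec k (c.received n w k) = w k
  have hle : Fintype.card (c.Good n) ≤ N := Fintype.card_subtype_le _
  have hbad' : (Fintype.card {w : ∀ i, Fin (numMessages T (R i)) //
      ¬ ∀ k, c.dec k (c.received n w k) = w k} : ℝ) ≤ N / 2 := by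
    calc _ ≤ ∑ k, ((Finset.univ.filter fun w => c.dec k (c.received n w k) ≠ w k).card : ℝ) := by
          exact_mod_cast hbad
      -- Union bound; `K + 1` keeps the threshold positive also for `K = 0`.
      _ ≤ ∑ _k : Fin K, N * (1 / (2 * ((K : ℝ) + 1))) := by
          refine Finset.sum_le_sum fun k _ => ?_
          have := h k
          rw [Code.errorProb, div_le_iff₀ hNpos] at this
          rw [mul_comm]
          exact this
      _ ≤ N / 2 := by
          rw [Finset.sum_const, Finset.card_univ, Fintype.card_fin, nsmul_eq_mul]
          have : (K : ℝ) * (1 / (2 * ((K : ℝ) + 1))) ≤ 1 / 2 := by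
            rw [mul_one_div, div_le_div_iff₀ (by positivity) (by positivity)]
            linarith
          nlinarith
  have h2 : (N : ℝ) ≤ 2 * Fintype.card (c.Good n) := by
    have : (Fintype.card {w : ∀ i, Fin (numMessages T (R i)) //
      ¬ ∀ k, c.dec k (c.received n w k) = w k} : ℝ) = N - Fintype.card (c.Good n) := by
      rw [hsplit, Nat.cast_sub hle]
    linarith
  exact_mod_cast h2

lemma mul_le_logb_numMessages (T : ℕ) (R : ℝ) : T * R ≤ Real.logb 2 (numMessages T R) := by
  rw [Real.le_logb_iff_rpow_le one_lt_two (by exact_mod_cast numMessages_pos T R)]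
  exact Nat.le_ceil _

/-- Dividing the finite-length bound by `T` leaves an excess `(K + 2) / T`, which tends to zero. -/
lemma Achievable.sum_le {K M : ℕ} {n : Fin M → Fin K → Fin K → ℕ} {R : Fin K → ℝ}
    (hR : Achievable n R) (hTIN : ∀ m, TINOptimal (n m)) {P : Fin M → Equiv.Perm (Fin K)}
    (hinv : ∀ m, ∀ X X' : Fin K → Signal,
      participatingOutput (n m) (P m) X = participatingOutput (n m) (P m) X' →
        participatingInput (n m) (P m) X = participatingInput (n m) (P m) X') :
    ∑ k, R k ≤ ∑ m, ((∑ i, (n m i i : ℝ)) - partitionWeight (n m) (P m)) := by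
  obtain ⟨-, c, hc⟩ := hR
  set C := ∑ m, ((∑ i, (n m i i : ℝ)) - partitionWeight (n m) (P m)) with hC
  have hev : ∀ᶠ T : ℕ in atTop, ∑ k, R k ≤ C + ((K : ℝ) + 2) / T := by
    have h1 : ∀ᶠ T in atTop, ∀ k, (c T).errorProb n k ≤ 1 / (2 * ((K : ℝ) + 1)) :=
      eventually_all.2 fun k => (hc k).eventually_le_const (by positivity)
    filter_upwards [h1, eventually_gt_atTop 0] with T hT hT0
    have h2 := (c T).sum_logb_numMessages_le hTIN hinv ((c T).card_le_two_mul_card_good hT)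
    have h3 : (T : ℝ) * ∑ k, R k ≤ ∑ k, Real.logb 2 (numMessages T (R k)) := by
      rw [Finset.mul_sum]
      exact Finset.sum_le_sum fun k _ => mul_le_logb_numMessages T (R k)
    have hT' : (0 : ℝ) < T := by exact_mod_cast hT0
    rw [← sub_le_iff_le_add', le_div_iff₀ hT']
    linarith
  refine ge_of_tendsto ?_ hev
  simpa using (tendsto_const_div_atTop_nhds_zero_nat ((K : ℝ) + 2)).const_add C

end Converse

end ADT

/-- The sum-capacity of the parallel network is the sum over the sub-channels of the best cyclic
partition bounds, and it is achieved by power control and treating interference as noise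
separately on each sub-channel (with power levels `r m i`): the rates `tinRate (n m) (r m) i` are
achievable on sub-channel `m` by itself, the total rates are in the capacity region of the whole
network, and they add up to the sum-capacity. -/
theorem theorem4 {K M : ℕ} (n : Fin M → Fin K → Fin K → ℕ)
    (hTIN : ∀ m, ADT.TINOptimal (n m)) (hinv : ∀ m, ADT.IsInvertible (n m))
    (P : Fin M → Equiv.Perm (Fin K)) (hP : ∀ m, ADT.IsOptimalPartition (n m) (P m)) :
    ADT.IsSumCapacity n
        (∑ m, ((∑ i, (n m i i : ℝ)) - (ADT.partitionWeight (n m) (P m) : ℝ))) ∧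
      ∃ r : Fin M → Fin K → ℕ,
        (∀ m, (fun i => ADT.tinRate (n m) (r m) i) ∈
          ADT.capacityRegion (fun _ : Fin 1 => n m)) ∧
        (∀ m, ∑ i, ADT.tinRate (n m) (r m) i =
          (∑ i, (n m i i : ℝ)) - (ADT.partitionWeight (n m) (P m) : ℝ)) ∧
        (fun i => ∑ m, ADT.tinRate (n m) (r m) i) ∈ ADT.capacityRegion n ∧
        ADT.IsSumCapacity n (∑ i, ∑ m, ADT.tinRate (n m) (r m) i) := by
  choose a r h1 h2 h3 h4 using fun m => ADT.exists_backoff (hTIN m) (hP m)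
  choose Q hQ hQinv using hinv
  have hrate : ∀ m i, ADT.tinRate (n m) (r m) i = (n m i i : ℝ) - r m i - a m i := fun m i =>
    ADT.tinRate_eq (h1 m i) (h2 m i) (h3 m i)
  -- The invertible optimal partition `Q m` may differ from `P m`, but only the common maximal
  -- weight enters the bound.
  have hweight : ∀ m, ADT.partitionWeight (n m) (Q m) = ADT.partitionWeight (n m) (P m) :=
    fun m => le_antisymm (hP m _) (hQ m _)
  have hsum : ∀ m, ∑ i, ADT.tinRate (n m) (r m) i =
      (∑ i, (n m i i : ℝ)) - (ADT.partitionWeight (n m) (P m) : ℝ) := by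
    intro m
    rw [← h4 m, Nat.cast_sum, ← Finset.sum_sub_distrib]
    refine Finset.sum_congr rfl fun i _ => ?_
    rw [hrate]
    push_cast
    ring
  have hmem : (fun i => ∑ m, ADT.tinRate (n m) (r m) i) ∈ ADT.capacityRegion n := by
    simp only [hrate]
    exact subset_closure (ADT.achievable_of_backoff n a r h1 h3)
  have htotal : ∑ i, ∑ m, ADT.tinRate (n m) (r m) i =
      ∑ m, ((∑ i, (n m i i : ℝ)) - (ADT.partitionWeight (n m) (P m) : ℝ)) := by
    rw [Finset.sum_comm]
    exact Finset.sum_congr rfl fun m _ => hsum m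
  have hcap : ADT.IsSumCapacity n
      (∑ m, ((∑ i, (n m i i : ℝ)) - (ADT.partitionWeight (n m) (P m) : ℝ))) := by
    refine ⟨⟨_, hmem, htotal⟩, ?_⟩
    rintro _ ⟨R, hR, rfl⟩
    -- The bound holds for achievable tuples and passes to the closure because it cuts out a closed
    -- half-space.
    have hclosed : IsClosed {R : Fin K → ℝ | ∑ k, R k ≤
        ∑ m, ((∑ i, (n m i i : ℝ)) - (ADT.partitionWeight (n m) (P m) : ℝ))} :=
      isClosed_le (by fun_prop) continuous_const
    refine closure_minimal (fun R hR => ?_) hclosed hR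
    have := ADT.Achievable.sum_le hR hTIN hQinv
    simpa only [hweight, Set.mem_ofPred_eq] using this
  refine ⟨hcap, r, fun m => ?_, hsum, hmem, by rwa [htotal]⟩
  have := ADT.achievable_of_backoff (fun _ : Fin 1 => n m) (fun _ => a m) (fun _ => r m)
    (fun _ => h1 m) (fun _ => h3 m)
  simp only [Finset.univ_unique, Finset.sum_singleton] at this
  simp only [hrate]
  exact subset_closure this
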